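/- Let $k,\Lambda\in\mathbb R$, let $f_0,f_1,\dots\in\mathbb R$, and let $\mathcal H,\mathcal G$ be differentiable real functions on a nonempty open set $U\subseteq\mathbb R$. For a pseudo-Riemannian metric $g_{\mu\nu}$ with Ricci tensor $R_{\mu\nu}$, scalar curvature $R$, Einstein tensor $G_{\mu\nu}=R_{\mu\nu}-\frac12Rg_{\mu\nu}$ and d'Alembert operator $\Box=\nabla^\mu\nabla_\mu$, and for a constant $G\neq0$, put $\mathcal F(\Box)=\sum_{n=0}^\infty f_n\Box^n$, $K_{\mu\nu}=\nabla_\mu\nabla_\nu-g_{\mu\nu}\Box$, $\Phi=\mathcal H'(R)\mathcal F(\Box)\mathcal G(R)+\mathcal G'(R)\mathcal F(\Box)\mathcal H(R)$ and $$E_{\mu\nu}=\frac{G_{\mu\nu}+\Lambda g_{\mu\nu}}{16\pi G}-\frac12g_{\mu\nu}\mathcal H(R)\mathcal F(\Box)\mathcal G(R)+R_{\mu\nu}\Phi-K_{\mu\nu}\Phi$$ $$\qquad+\frac12\sum_{n=1}^\infty f_n\sum_{l=0}^{n-1}\Big(g_{\mu\nu}\,\partial^\alpha\Box^l\mathcal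 H(R)\,\partial_\alpha\Box^{n-1-l}\mathcal G(R)-2\,\partial_\mu\Box^l\mathcal H(R)\,\partial_\nu\Box^{n-1-l}\mathcal G(R)+g_{\mu\nu}\,\Box^l\mathcal H(R)\,\Box^{n-l}\mathcal G(R)\Big),$$ so that the field equations are $E_{\mu\nu}=0$ for all $\mu,\nu$. In dimension four put $$T=\frac{4\Lambda-R}{16\pi G}-2\mathcal H(R)\mathcal F(\Box)\mathcal G(R)+R\Phi+3\Box\Phi+\sum_{n=1}^\infty f_n\sum_{l=0}^{n-1}\Big(\partial^\mu\Box^l\mathcal H(R)\,\partial_\mu\Box^{n-1-l}\mathcal G(R)+2\,\Box^l\mathcal H(R)\,\Box^{n-l}\mathcal G(R)\Big).$$ Consider FLRW metrics $$ds^2=-dt^2+a(t)^2\Big(\frac{dr^2}{1-kr^2}+r^2d\theta^2+r^2\sin^2\theta\,d\varphi^2\Big)$$ for $t$ in an open set $I\subseteq\mathbb R$, $r>0$, $kr^2<1$, $0<\theta<\pi$, with coordinates $(x^0,x^1,x^2,x^3)=(t,r,\theta,\varphi)$, where $a:I\to(0,\infty)$ is $C^2$. Call $(I,a)$ admissible if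 $R$ takes values in $U$, the functions $\Box^l\mathcal H(R)$ and $\Box^l\mathcal G(R)$ for $l<n$ with $f_n\ne0$, as well as $\Phi$, are $C^2$, and the series $\mathcal F(\Box)\mathcal H(R)$, $\mathcal F(\Box)\mathcal G(R)$ and the series in each $E_{\mu\nu}$ converge at every point. (1) For every $G\neq0$ and every admissible $(I,a)$, at every point: (i) $E_{\mu\nu}=0$ whenever $\mu\neq\nu$; (ii) there is a number $c$ with $E_{ii}=c\,g_{ii}$ for $i=1,2,3$; (iii) the series in $T$ converges and $T=g^{\mu\nu}E_{\mu\nu}$; (iv) $E_{\mu\nu}=0$ for all $\mu,\nu$ if and only if $$T=0\qquad\text{and}\qquad E_{00}=0 .$$ (2) These two equations are linearly independent: for every point $(t_0,r_0,\theta_0,\varphi_0)$ with $r_0>0$, $kr_0^2<1$, $0<\theta_0<\pi$ and every $a_0>0$, the values of $T$ and of $E_{00}$ at this point, regarded as real functions of the constant $G>0$ and of the admissible pair $(I,a)$ with $t_0\in I$, $a$ smooth on $I$ and $a(t_0)=a_0$, are linearly independent over $\mathbb R$. -/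

import Mathlib

open scoped ContDiff

noncomputable section

namespace NonlocalGravity

/-! ### Pseudo-Riemannian geometry in a coordinate chart

Coordinates are points of `Fin n → ℝ`; a metric is the matrix field of its components `g_{μν}`. -/

/-- Convergent series `∑_{n=0}^∞ u n`, in the usual sense of limits of partial sums. -/
abbrev SeriesConverges (u : ℕ → ℝ) : Prop := Summable u (SummationFilter.conditional ℕ)

/-- The sum `∑_{n=0}^∞ u n`, in the usual sense of limits of partial sums. -/
abbrev seriesSum (u : ℕ → ℝ) : ℝ := ∑'[SummationFilter.conditional ℕ] n, u n

variable {n : ℕ}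

/-- The partial derivative `∂_μ u`. -/
def pd (μ : Fin n) (u : (Fin n → ℝ) → ℝ) (x : Fin n → ℝ) : ℝ :=
  deriv (fun s => u (Function.update x μ s)) (x μ)

/-- The components `g^{μν}` of the inverse metric. -/
def invMetric (g : (Fin n → ℝ) → Matrix (Fin n) (Fin n) ℝ) (x : Fin n → ℝ) :
    Matrix (Fin n) (Fin n) ℝ :=
  (g x)⁻¹

/-- The Christoffel symbols
`Γ^l_{μν} = (1/2) g^{lσ} (∂_μ g_{νσ} + ∂_ν g_{μσ} - ∂_σ g_{μν})`. -/
def christoffel (g : (Fin n → ℝ) → Matrix (Fin n) (Fin n) ℝ) (l μ ν : Fin n)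
    (x : Fin n → ℝ) : ℝ :=
  (1 / 2) * ∑ σ, invMetric g x l σ *
    (pd μ (fun y => g y ν σ) x + pd ν (fun y => g y μ σ) x - pd σ (fun y => g y μ ν) x)

/-- The Ricci tensor
`R_{μν} = ∂_α Γ^α_{μν} - ∂_ν Γ^α_{μα} + Γ^α_{αβ} Γ^β_{μν} - Γ^α_{νβ} Γ^β_{αμ}`. -/
def ricci (g : (Fin n → ℝ) → Matrix (Fin n) (Fin n) ℝ) (μ ν : Fin n)
    (x : Fin n → ℝ) : ℝ :=
  ∑ α, (pd α (christoffel g α μ ν) x - pd ν (christoffel g α μ α) x)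
    + ∑ α, ∑ β, (christoffel g α α β x * christoffel g β μ ν x
        - christoffel g α ν β x * christoffel g β α μ x)

/-- The scalar curvature `R = g^{μν} R_{μν}`. -/
def scalarCurvature (g : (Fin n → ℝ) → Matrix (Fin n) (Fin n) ℝ) (x : Fin n → ℝ) : ℝ :=
  ∑ μ, ∑ ν, invMetric g x μ ν * ricci g μ ν x

/-- The Einstein tensor `G_{μν} = R_{μν} - (1/2) R g_{μν}`. -/
def einstein (g : (Fin n → ℝ) → Matrix (Fin n) (Fin n) ℝ) (μ ν : Fin n)
    (x : Fin n → ℝ) : ℝ :=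
  ricci g μ ν x - (1 / 2) * scalarCurvature g x * g x μ ν

/-- The second covariant derivative `∇_μ ∇_ν u = ∂_μ ∂_ν u - Γ^l_{μν} ∂_l u` of a scalar `u`. -/
def hess (g : (Fin n → ℝ) → Matrix (Fin n) (Fin n) ℝ) (u : (Fin n → ℝ) → ℝ)
    (μ ν : Fin n) (x : Fin n → ℝ) : ℝ :=
  pd μ (pd ν u) x - ∑ l, christoffel g l μ ν x * pd l u x

/-- The d'Alembert operator `□ u = ∇^μ ∇_μ u` on scalars. -/
def box (g : (Fin n → ℝ) → Matrix (Fin n) (Fin n) ℝ) (u : (Fin n → ℝ) → ℝ)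
    (x : Fin n → ℝ) : ℝ :=
  ∑ μ, ∑ ν, invMetric g x μ ν * hess g u μ ν x

/-- The iterate `□^l u`. -/
def boxPow (g : (Fin n → ℝ) → Matrix (Fin n) (Fin n) ℝ) (l : ℕ) (u : (Fin n → ℝ) → ℝ) :
    (Fin n → ℝ) → ℝ :=
  (box g)^[l] u

/-- The contraction `∂^α u ∂_α v = g^{αβ} ∂_α u ∂_β v`. -/
def gradDot (g : (Fin n → ℝ) → Matrix (Fin n) (Fin n) ℝ) (u v : (Fin n → ℝ) → ℝ)
    (x : Fin n → ℝ) : ℝ :=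
  ∑ α, ∑ β, invMetric g x α β * pd α u x * pd β v x

/-- The operator `K_{μν} u = ∇_μ ∇_ν u - g_{μν} □ u`. -/
def opK (g : (Fin n → ℝ) → Matrix (Fin n) (Fin n) ℝ) (u : (Fin n → ℝ) → ℝ)
    (μ ν : Fin n) (x : Fin n → ℝ) : ℝ :=
  hess g u μ ν x - g x μ ν * box g u x

/-! ### The field equations -/

/-- The scalar field `H(R)`. -/
def ofR (g : (Fin n → ℝ) → Matrix (Fin n) (Fin n) ℝ) (H : ℝ → ℝ) (x : Fin n → ℝ) : ℝ :=
  H (scalarCurvature g x)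

/-- `F(□) u = ∑_{m=0}^∞ f_m □^m u`. -/
def opF (g : (Fin n → ℝ) → Matrix (Fin n) (Fin n) ℝ) (f : ℕ → ℝ) (u : (Fin n → ℝ) → ℝ)
    (x : Fin n → ℝ) : ℝ :=
  seriesSum fun m => f m * boxPow g m u x

/-- `Φ = H'(R) F(□) G(R) + G'(R) F(□) H(R)`. -/
def Phi (g : (Fin n → ℝ) → Matrix (Fin n) (Fin n) ℝ) (f : ℕ → ℝ) (H G : ℝ → ℝ)
    (x : Fin n → ℝ) : ℝ :=
  ofR g (deriv H) x * opF g f (ofR g G) x + ofR g (deriv G) x * opF g f (ofR g H) x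

/-- The `m`-th term of the series in the field equations,
`f_m ∑_{l=0}^{m-1} (g_{μν} ∂^α □^l H(R) ∂_α □^{m-1-l} G(R)
  - 2 ∂_μ □^l H(R) ∂_ν □^{m-1-l} G(R) + g_{μν} □^l H(R) □^{m-l} G(R))`.
The term with `m = 0` is `0`. -/
def eomTerm (g : (Fin n → ℝ) → Matrix (Fin n) (Fin n) ℝ) (f : ℕ → ℝ) (H G : ℝ → ℝ)
    (μ ν : Fin n) (x : Fin n → ℝ) (m : ℕ) : ℝ :=
  f m * ∑ l ∈ Finset.range m,
    (g x μ ν * gradDot g (boxPow g l (ofR g H)) (boxPow g (m - 1 - l) (ofR g G)) x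
      - 2 * pd μ (boxPow g l (ofR g H)) x * pd ν (boxPow g (m - 1 - l) (ofR g G)) x
      + g x μ ν * boxPow g l (ofR g H) x * boxPow g (m - l) (ofR g G) x)

/-- The left-hand side `E_{μν}` of the field equations, with Newton constant `N` and
cosmological constant `Λ`. -/
def eom (g : (Fin n → ℝ) → Matrix (Fin n) (Fin n) ℝ) (N Λ : ℝ) (f : ℕ → ℝ) (H G : ℝ → ℝ)
    (μ ν : Fin n) (x : Fin n → ℝ) : ℝ :=
  (einstein g μ ν x + Λ * g x μ ν) / (16 * Real.pi * N)
    - (1 / 2) * g x μ ν * ofR g H x * opF g f (ofR g G) x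
    + (ricci g μ ν x * Phi g f H G x - opK g (Phi g f H G) μ ν x)
    + (1 / 2) * seriesSum (eomTerm g f H G μ ν x)

/-- The `m`-th term of the series in the trace equation,
`f_m ∑_{l=0}^{m-1} (∂^μ □^l H(R) ∂_μ □^{m-1-l} G(R) + 2 □^l H(R) □^{m-l} G(R))`. -/
def traceTerm (g : (Fin n → ℝ) → Matrix (Fin n) (Fin n) ℝ) (f : ℕ → ℝ) (H G : ℝ → ℝ)
    (x : Fin n → ℝ) (m : ℕ) : ℝ :=
  f m * ∑ l ∈ Finset.range m,
    (gradDot g (boxPow g l (ofR g H)) (boxPow g (m - 1 - l) (ofR g G)) x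
      + 2 * boxPow g l (ofR g H) x * boxPow g (m - l) (ofR g G) x)

/-- The left-hand side of the trace equation (in dimension four). -/
def traceEq (g : (Fin 4 → ℝ) → Matrix (Fin 4) (Fin 4) ℝ) (N Λ : ℝ) (f : ℕ → ℝ) (H G : ℝ → ℝ)
    (x : Fin 4 → ℝ) : ℝ :=
  (4 * Λ - scalarCurvature g x) / (16 * Real.pi * N)
    - 2 * ofR g H x * opF g f (ofR g G) x
    + (scalarCurvature g x * Phi g f H G x + 3 * box g (Phi g f H G) x)
    + seriesSum (traceTerm g f H G x)

/-! ### The FLRW metric -/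

/-- The FLRW metric
`ds² = -dt² + a(t)² (dr² / (1 - k r²) + r² dθ² + r² sin² θ dφ²)`
in the coordinates `x 0 = t`, `x 1 = r`, `x 2 = θ`, `x 3 = φ`. -/
def flrw (k : ℝ) (a : ℝ → ℝ) (x : Fin 4 → ℝ) : Matrix (Fin 4) (Fin 4) ℝ :=
  Matrix.diagonal ![-1, a (x 0) ^ 2 / (1 - k * x 1 ^ 2), a (x 0) ^ 2 * x 1 ^ 2,
    a (x 0) ^ 2 * x 1 ^ 2 * Real.sin (x 2) ^ 2]

/-- The domain of the coordinates `(t, r, θ, φ)` over the set `I` of times. -/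
def flrwChart (k : ℝ) (I : Set ℝ) : Set (Fin 4 → ℝ) :=
  {x | x 0 ∈ I ∧ 0 < x 1 ∧ k * x 1 ^ 2 < 1 ∧ 0 < x 2 ∧ x 2 < Real.pi}

/-- `a` is a scale factor on the open set `I` of times for which every derivative and every
series in the field equations exists; `H` and `G` are functions on `U`. -/
structure Admissible (k : ℝ) (U : Set ℝ) (f : ℕ → ℝ) (H G : ℝ → ℝ) (I : Set ℝ) (a : ℝ → ℝ) :
    Prop where
  isOpen : IsOpen I
  contDiffOn : ContDiffOn ℝ 2 a I
  pos : ∀ t ∈ I, 0 < a t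
  scalar_mem : ∀ x ∈ flrwChart k I, scalarCurvature (flrw k a) x ∈ U
  contDiffOn_boxPow : ∀ m, f m ≠ 0 → ∀ l < m,
    ContDiffOn ℝ 2 (boxPow (flrw k a) l (ofR (flrw k a) H)) (flrwChart k I) ∧
    ContDiffOn ℝ 2 (boxPow (flrw k a) l (ofR (flrw k a) G)) (flrwChart k I)
  contDiffOn_Phi : ContDiffOn ℝ 2 (Phi (flrw k a) f H G) (flrwChart k I)
  converges_opF : ∀ x ∈ flrwChart k I,
    SeriesConverges (fun m => f m * boxPow (flrw k a) m (ofR (flrw k a) H) x) ∧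
    SeriesConverges (fun m => f m * boxPow (flrw k a) m (ofR (flrw k a) G) x)
  converges_eom : ∀ x ∈ flrwChart k I, ∀ μ ν, SeriesConverges (eomTerm (flrw k a) f H G μ ν x)

/-- Choices of a Newton constant `N > 0` and a smooth admissible scale factor `a` on an open set
`I` of times that contains `t₀`, with `a t₀ = a₀`. -/
def Family (k : ℝ) (U : Set ℝ) (f : ℕ → ℝ) (H G : ℝ → ℝ) (t₀ a₀ : ℝ) : Type :=
  {q : ℝ × Set ℝ × (ℝ → ℝ) // 0 < q.1 ∧ Admissible k U f H G q.2.1 q.2.2 ∧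
    ContDiffOn ℝ ∞ q.2.2 q.2.1 ∧ t₀ ∈ q.2.1 ∧ q.2.2 t₀ = a₀}

end NonlocalGravity

end

open scoped ContDiff

noncomputable section

namespace NonlocalGravity

variable {n : ℕ}

/-! Homogeneity and isotropy do the work. On the chart, `R` and every scalar built from it by `□`,
`F(□)` and products depends on `t` alone. The Ricci tensor, the Hessian of a function of `t` and
each term of the series then have the form `c_μ g_{μν}` (no summation) with `c_1 = c_2 = c_3`. So
`E_{μν} = e_μ g_{μν}` with three equal spatial coefficients (`eom_flrw`, `flrwEom_spatial`), and the
trace is `T = e_0 + 3 e_1` (`Admissible.traceEq_flrw`). All of part (1) follows, since `e_0 = 0` and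
`T = 0` force `e_1 = 0`.

For part (2), the test family has constant curvature `R = r` with `r ∈ U` and `r ≠ 0, 4Λ`. There `□`
kills `H(R)` and `G(R)`, so admissibility is automatic. Newton's constant enters only through
`1/(16πN)`; subtracting a relation at `N = 2` from the one at `N = 1` removes every nonlocal term
and leaves `α (4Λ - r) + β (G_00 + Λ g_00) = 0`. Prescribing `a(t₀) = a₀` leaves `v = a'(t₀)` free.
As `G_00` varies with `v`, `β = 0`; then `r ≠ 4Λ` gives `α = 0`. -/

theorem pd_congr {C : Set (Fin n → ℝ)} (hC : IsOpen C) {u v : (Fin n → ℝ) → ℝ}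
    (h : ∀ y ∈ C, u y = v y) {x : Fin n → ℝ} (hx : x ∈ C) (μ : Fin n) : pd μ u x = pd μ v x := by
  have hc : Continuous fun s : ℝ => Function.update x μ s :=
    continuous_const.update μ continuous_id
  refine Filter.EventuallyEq.deriv_eq ?_
  filter_upwards [(hC.preimage hc).mem_nhds (by simpa using hx)] with s hs using h _ hs

theorem isOpen_flrwChart (k : ℝ) {I : Set ℝ} (hI : IsOpen I) : IsOpen (flrwChart k I) := by
  have h (i : Fin 4) : Continuous fun x : Fin 4 → ℝ => x i := continuous_apply i
  have h' : Continuous fun x : Fin 4 → ℝ => k * x 1 ^ 2 := by fun_prop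
  exact (hI.preimage (h 0)).inter ((isOpen_lt continuous_const (h 1)).inter
    ((isOpen_lt h' continuous_const).inter ((isOpen_lt continuous_const (h 2)).inter
      (isOpen_lt (h 2) continuous_const))))

/-- The product of functions of the time, the radius and the polar angle. -/
def sepProd (p q s : ℝ → ℝ) (x : Fin 4 → ℝ) : ℝ := p (x 0) * q (x 1) * s (x 2)

/-- The metric components and Christoffel symbols are all separated products, so partial derivatives
reduce to one-variable ones. Constant factors leave `deriv` unconditionally, hence no
differentiability is assumed. -/
theorem pd_zero_sepProd (p q s : ℝ → ℝ) (x : Fin 4 → ℝ) :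
    pd 0 (sepProd p q s) x = deriv p (x 0) * q (x 1) * s (x 2) := by
  simp [pd, sepProd]

theorem pd_one_sepProd (p q s : ℝ → ℝ) (x : Fin 4 → ℝ) :
    pd 1 (sepProd p q s) x = p (x 0) * deriv q (x 1) * s (x 2) := by
  simp [pd, sepProd]

theorem pd_two_sepProd (p q s : ℝ → ℝ) (x : Fin 4 → ℝ) :
    pd 2 (sepProd p q s) x = p (x 0) * q (x 1) * deriv s (x 2) := by
  simp [pd, sepProd]

theorem pd_three_sepProd (p q s : ℝ → ℝ) (x : Fin 4 → ℝ) :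
    pd 3 (sepProd p q s) x = 0 := by
  simp [pd, sepProd]

theorem pd_const (c : ℝ) (μ : Fin n) (x : Fin n → ℝ) : pd μ (fun _ => c) x = 0 := by
  simp [pd]

/-! ### Connection and curvature of the FLRW metric -/

/-- The scale factor `a` is positive and of class `C²` on the open set `I`. -/
structure ScaleFactor (I : Set ℝ) (a : ℝ → ℝ) : Prop where
  isOpen : IsOpen I
  contDiffOn : ContDiffOn ℝ 2 a I
  pos : ∀ t ∈ I, 0 < a t

variable {k : ℝ} {I : Set ℝ} {a : ℝ → ℝ} {x : Fin 4 → ℝ}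

theorem ScaleFactor.hasDerivAt (ha : ScaleFactor I a) {t : ℝ} (ht : t ∈ I) :
    HasDerivAt a (deriv a t) t :=
  ((ha.contDiffOn.differentiableOn (by norm_num)).differentiableAt
    (ha.isOpen.mem_nhds ht)).hasDerivAt

theorem ScaleFactor.hasDerivAt_deriv (ha : ScaleFactor I a) {t : ℝ} (ht : t ∈ I) :
    HasDerivAt (deriv a) (deriv (deriv a) t) t :=
  (((contDiffOn_succ_iff_deriv_of_isOpen (n := 1) ha.isOpen).1
    (by rw [one_add_one_eq_two]; exact ha.contDiffOn)).2.2.differentiableOn (by norm_num)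
      |>.differentiableAt (ha.isOpen.mem_nhds ht)).hasDerivAt

/-- The components of the inverse FLRW metric. -/
def flrwInv (k : ℝ) (a : ℝ → ℝ) (x : Fin 4 → ℝ) : Fin 4 → ℝ :=
  ![-1, (1 - k * x 1 ^ 2) / a (x 0) ^ 2, 1 / (a (x 0) ^ 2 * x 1 ^ 2),
    1 / (a (x 0) ^ 2 * x 1 ^ 2 * Real.sin (x 2) ^ 2)]

theorem invMetric_flrw (ha : ScaleFactor I a) (hx : x ∈ flrwChart k I) :
    invMetric (flrw k a) x = Matrix.diagonal (flrwInv k a x) := by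
  obtain ⟨h0, h1, h2, h3, h4⟩ := hx
  have ha0 := (ha.pos _ h0).ne'
  have hk : 1 - k * x 1 ^ 2 ≠ 0 := by linarith
  have hs := (Real.sin_pos_of_pos_of_lt_pi h3 h4).ne'
  refine Matrix.inv_eq_right_inv ?_
  rw [flrw, Matrix.diagonal_mul_diagonal, ← Matrix.diagonal_one]
  congr 1
  funext i
  fin_cases i <;> simp [flrwInv] <;> field_simp

/-- The diagonal components of the FLRW metric. -/
def flrwDiag (k : ℝ) (a : ℝ → ℝ) : Fin 4 → (Fin 4 → ℝ) → ℝ :=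
  ![sepProd (fun _ => -1) (fun _ => 1) (fun _ => 1),
    sepProd (fun t => a t ^ 2) (fun r => 1 / (1 - k * r ^ 2)) (fun _ => 1),
    sepProd (fun t => a t ^ 2) (fun r => r ^ 2) (fun _ => 1),
    sepProd (fun t => a t ^ 2) (fun r => r ^ 2) (fun θ => Real.sin θ ^ 2)]

theorem flrw_apply (k : ℝ) (a : ℝ → ℝ) (x : Fin 4 → ℝ) (μ ν : Fin 4) :
    flrw k a x μ ν = if μ = ν then flrwDiag k a μ x else 0 := by
  rw [flrw, Matrix.diagonal_apply]
  congr 1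
  fin_cases μ <;> simp [flrwDiag, sepProd, div_eq_mul_inv]

theorem pd_flrw (k : ℝ) (a : ℝ → ℝ) (x : Fin 4 → ℝ) (σ μ ν : Fin 4) :
    pd σ (fun y => flrw k a y μ ν) x = if μ = ν then pd σ (flrwDiag k a μ) x else 0 := by
  simp only [flrw_apply]
  split_ifs
  · rfl
  · exact pd_const 0 σ x

theorem deriv_sq_scale (ha : ScaleFactor I a) {t : ℝ} (ht : t ∈ I) :
    deriv (fun t => a t ^ 2) t = 2 * a t * deriv a t := by
  simpa using ((ha.hasDerivAt ht).fun_pow 2).deriv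

theorem hasDerivAt_curv (r : ℝ) :
    HasDerivAt (fun r : ℝ => 1 - k * r ^ 2) (-(2 * k * r)) r :=
  (((hasDerivAt_pow 2 r).const_mul k).const_sub 1).congr_deriv (by norm_num; ring)

theorem deriv_inv_curv {r : ℝ} (h : 1 - k * r ^ 2 ≠ 0) :
    deriv (fun r => 1 / (1 - k * r ^ 2)) r = 2 * k * r / (1 - k * r ^ 2) ^ 2 := by
  have := ((hasDerivAt_curv r).fun_inv h).deriv
  simp only [one_div]
  rw [this]; simp

theorem deriv_sin_sq (θ : ℝ) :
    deriv (fun θ => Real.sin θ ^ 2) θ = 2 * Real.sin θ * Real.cos θ := by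
  simp

theorem deriv_sq (r : ℝ) : deriv (fun r : ℝ => r ^ 2) r = 2 * r := by simp

/-- The Christoffel symbols of the FLRW metric. -/
def flrwGamma (k : ℝ) (a : ℝ → ℝ) (l μ ν : Fin 4) : (Fin 4 → ℝ) → ℝ :=
  let o : (Fin 4 → ℝ) → ℝ := fun _ => 0
  let h := sepProd (fun t => deriv a t / a t) (fun _ => 1) (fun _ => 1)
  let i := sepProd (fun _ => 1) (fun r => r⁻¹) (fun _ => 1)
  let c := sepProd (fun _ => 1) (fun _ => 1) (fun θ => Real.cos θ / Real.sin θ)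
  (![!![o, o, o, o;
        o, sepProd (fun t => a t * deriv a t) (fun r => 1 / (1 - k * r ^ 2)) (fun _ => 1), o, o;
        o, o, sepProd (fun t => a t * deriv a t) (fun r => r ^ 2) (fun _ => 1), o;
        o, o, o, sepProd (fun t => a t * deriv a t) (fun r => r ^ 2) (fun θ => Real.sin θ ^ 2)],
     !![o, h, o, o;
        h, sepProd (fun _ => 1) (fun r => k * r / (1 - k * r ^ 2)) (fun _ => 1), o, o;
        o, o, sepProd (fun _ => -1) (fun r => r * (1 - k * r ^ 2)) (fun _ => 1), o;
        o, o, o, sepProd (fun _ => -1) (fun r => r * (1 - k * r ^ 2))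
          (fun θ => Real.sin θ ^ 2)],
     !![o, o, h, o;
        o, o, i, o;
        h, i, o, o;
        o, o, o, sepProd (fun _ => -1) (fun _ => 1) (fun θ => Real.sin θ * Real.cos θ)],
     !![o, o, o, h;
        o, o, o, i;
        o, o, o, c;
        h, i, c, o]] : Fin 4 → Matrix (Fin 4) (Fin 4) ((Fin 4 → ℝ) → ℝ)) l μ ν

/-- The inverse metric is diagonal, so only `σ = l` survives in the defining sum. -/
theorem christoffel_eq (ha : ScaleFactor I a) (hx : x ∈ flrwChart k I) (l μ ν : Fin 4) :
    christoffel (flrw k a) l μ ν x = (1 / 2) * flrwInv k a x l *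
      ((if ν = l then pd μ (flrwDiag k a ν) x else 0)
        + (if μ = l then pd ν (flrwDiag k a μ) x else 0)
        - (if μ = ν then pd l (flrwDiag k a μ) x else 0)) := by
  rw [christoffel, invMetric_flrw ha hx, Finset.sum_eq_single l]
  · simp only [pd_flrw, Matrix.diagonal_apply_eq]; ring
  · intro σ _ hσ
    rw [Matrix.diagonal_apply_ne _ hσ.symm, zero_mul]
  · simp

theorem christoffel_flrw (ha : ScaleFactor I a) (hx : x ∈ flrwChart k I) (l μ ν : Fin 4) :
    christoffel (flrw k a) l μ ν x = flrwGamma k a l μ ν x := by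
  rw [christoffel_eq ha hx]
  obtain ⟨h0, h1, h2, h3, h4⟩ := hx
  have ha0 := (ha.pos _ h0).ne'
  have hk : 1 - k * x 1 ^ 2 ≠ 0 := by linarith
  have hs := (Real.sin_pos_of_pos_of_lt_pi h3 h4).ne'
  have d1 := deriv_sq_scale ha h0
  have d2 := deriv_inv_curv hk
  have d3 := deriv_sin_sq (x 2)
  have d4 := deriv_sq (x 1)
  have d5 (c y : ℝ) : deriv (fun _ => c) y = 0 := deriv_const _ _
  fin_cases l <;> fin_cases μ <;> fin_cases ν <;>
    simp [-one_div, -deriv_fun_pow, flrwDiag, flrwInv, flrwGamma, pd_zero_sepProd,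
      pd_one_sepProd, pd_two_sepProd, pd_three_sepProd, sepProd, d1, d2, d3, d4, d5] <;>
    field_simp

theorem deriv_mul_deriv_scale (ha : ScaleFactor I a) {t : ℝ} (ht : t ∈ I) :
    deriv (fun t => a t * deriv a t) t = deriv a t ^ 2 + a t * deriv (deriv a) t := by
  rw [((ha.hasDerivAt ht).fun_mul (ha.hasDerivAt_deriv ht)).deriv]; ring

theorem deriv_hubble (ha : ScaleFactor I a) {t : ℝ} (ht : t ∈ I) :
    deriv (fun t => deriv a t / a t) t =
      deriv (deriv a) t / a t - (deriv a t / a t) ^ 2 := by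
  have h := (ha.pos t ht).ne'
  rw [((ha.hasDerivAt_deriv ht).fun_div (ha.hasDerivAt ht) h).deriv]; field_simp

theorem deriv_gamma_radial {r : ℝ} (h : 1 - k * r ^ 2 ≠ 0) :
    deriv (fun r => k * r / (1 - k * r ^ 2)) r =
      k * (1 + k * r ^ 2) / (1 - k * r ^ 2) ^ 2 := by
  rw [(((hasDerivAt_id' r).const_mul k).fun_div (hasDerivAt_curv r) h).deriv]; ring

theorem deriv_mul_curv (r : ℝ) :
    deriv (fun r => r * (1 - k * r ^ 2)) r = 1 - 3 * k * r ^ 2 := by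
  rw [((hasDerivAt_id' r).fun_mul (hasDerivAt_curv r)).deriv]; ring

theorem deriv_sin_mul_cos (θ : ℝ) :
    deriv (fun θ => Real.sin θ * Real.cos θ) θ = Real.cos θ ^ 2 - Real.sin θ ^ 2 := by
  rw [((Real.hasDerivAt_sin θ).fun_mul (Real.hasDerivAt_cos θ)).deriv]; ring

theorem deriv_cot {θ : ℝ} (h : Real.sin θ ≠ 0) :
    deriv (fun θ => Real.cos θ / Real.sin θ) θ = -1 - (Real.cos θ / Real.sin θ) ^ 2 := by
  rw [((Real.hasDerivAt_cos θ).fun_div (Real.hasDerivAt_sin θ) h).deriv]; field_simp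

theorem deriv_inv_radial (r : ℝ) : deriv (fun r : ℝ => r⁻¹) r = -(r⁻¹ ^ 2) := by simp

/-- The closed form of the Christoffel symbols holds on the whole open chart, so it may also be used
under the derivatives. -/
theorem ricci_flrw_eq (ha : ScaleFactor I a) (hx : x ∈ flrwChart k I) (μ ν : Fin 4) :
    ricci (flrw k a) μ ν x =
      ∑ α, (pd α (flrwGamma k a α μ ν) x - pd ν (flrwGamma k a α μ α) x)
        + ∑ α, ∑ β, (flrwGamma k a α α β x * flrwGamma k a β μ ν x
          - flrwGamma k a α ν β x * flrwGamma k a β α μ x) := by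
  have h (β l μ ν : Fin 4) : pd β (christoffel (flrw k a) l μ ν) x =
      pd β (flrwGamma k a l μ ν) x :=
    pd_congr (isOpen_flrwChart k ha.isOpen) (fun y hy => christoffel_flrw ha hy l μ ν) hx β
  simp only [ricci, h, christoffel_flrw ha hx]

/-- The coefficients of the Ricci tensor of the FLRW metric with respect to the metric. -/
def flrwRicci (k : ℝ) (a : ℝ → ℝ) (t : ℝ) : Fin 4 → ℝ :=
  let s := deriv (deriv a) t / a t + 2 * (deriv a t / a t) ^ 2 + 2 * k / a t ^ 2
  ![3 * (deriv (deriv a) t / a t), s, s, s]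

theorem ricci_flrw (ha : ScaleFactor I a) (hx : x ∈ flrwChart k I) (μ ν : Fin 4) :
    ricci (flrw k a) μ ν x = flrwRicci k a (x 0) μ * flrw k a x μ ν := by
  rw [ricci_flrw_eq ha hx, flrw_apply]
  obtain ⟨h0, h1, h2, h3, h4⟩ := hx
  have ha0 := (ha.pos _ h0).ne'
  have hk : 1 - k * x 1 ^ 2 ≠ 0 := by linarith
  have hk' : 1 - x 1 ^ 2 * k ≠ 0 := by rwa [mul_comm]
  have hs := (Real.sin_pos_of_pos_of_lt_pi h3 h4).ne'
  have hr := h1.ne'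
  have d1 := deriv_mul_deriv_scale ha h0
  have d2 := deriv_hubble ha h0
  have d5 (c y : ℝ) : deriv (fun _ => c) y = 0 := deriv_const _ _
  have d7 := deriv_gamma_radial hk
  have d8 := deriv_mul_curv (k := k) (x 1)
  have d9 := deriv_sin_mul_cos (x 2)
  have d10 := deriv_cot hs
  have d11 := deriv_inv_radial (x 1)
  fin_cases μ <;> fin_cases ν <;>
    simp [-one_div, -deriv_fun_pow, Fin.sum_univ_four, flrwDiag, flrwGamma, flrwRicci,
      pd_zero_sepProd, pd_one_sepProd, pd_two_sepProd, pd_three_sepProd, pd_const,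
      d1, d2, d5, d7, d8, d9, d10, d11] <;>
    simp [sepProd] <;> field_simp <;>
    -- The remaining angular identities are polynomial once `cos²` is replaced by `1 - sin²`.
    (try simp only [Real.cos_sq']) <;> (try field_simp) <;> ring

/-! ### Contractions and functions of the time -/

variable {u v : (Fin 4 → ℝ) → ℝ} {f : ℕ → ℝ} {H G : ℝ → ℝ}

theorem flrwInv_mul_flrw (ha : ScaleFactor I a) (hx : x ∈ flrwChart k I) (μ : Fin 4) :
    flrwInv k a x μ * flrw k a x μ μ = 1 := by
  obtain ⟨h0, h1, h2, h3, h4⟩ := hx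
  have ha0 := (ha.pos _ h0).ne'
  have hk : 1 - k * x 1 ^ 2 ≠ 0 := by linarith
  have hs := (Real.sin_pos_of_pos_of_lt_pi h3 h4).ne'
  fin_cases μ <;> simp [flrwInv, flrw] <;> field_simp

theorem sum_invMetric_mul (ha : ScaleFactor I a) (hx : x ∈ flrwChart k I)
    (M : Fin 4 → Fin 4 → ℝ) :
    ∑ μ, ∑ ν, invMetric (flrw k a) x μ ν * M μ ν = ∑ μ, flrwInv k a x μ * M μ μ := by
  simp [invMetric_flrw ha hx, Matrix.diagonal_apply]

/-- This is the gain from writing tensors as `c_μ g_{μν}`: since `g^{μμ} g_{μμ} = 1`, a trace is the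
sum of the coefficients. -/
theorem sum_invMetric_mul_flrw (ha : ScaleFactor I a) (hx : x ∈ flrwChart k I)
    (c : Fin 4 → ℝ) :
    ∑ μ, ∑ ν, invMetric (flrw k a) x μ ν * (c μ * flrw k a x μ ν) = ∑ μ, c μ := by
  rw [sum_invMetric_mul ha hx fun μ ν => c μ * flrw k a x μ ν]
  refine Finset.sum_congr rfl fun μ _ => ?_
  rw [mul_left_comm, flrwInv_mul_flrw ha hx, mul_one]

theorem scalarCurvature_eq_sum (ha : ScaleFactor I a) (hx : x ∈ flrwChart k I) :
    scalarCurvature (flrw k a) x = ∑ μ, flrwRicci k a (x 0) μ := by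
  simp only [scalarCurvature, ricci_flrw ha hx]
  exact sum_invMetric_mul_flrw ha hx _

theorem scalarCurvature_flrw (ha : ScaleFactor I a) (hx : x ∈ flrwChart k I) :
    scalarCurvature (flrw k a) x =
      6 * (deriv (deriv a) (x 0) / a (x 0) + (deriv a (x 0) / a (x 0)) ^ 2
        + k / a (x 0) ^ 2) := by
  rw [scalarCurvature_eq_sum ha hx]
  simp [Fin.sum_univ_four, flrwRicci]
  ring

/-- On the set `C`, the function `u` depends on the time only. -/
def IsTimeFun (C : Set (Fin 4 → ℝ)) (u : (Fin 4 → ℝ) → ℝ) : Prop :=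
  ∃ φ : ℝ → ℝ, ∀ x ∈ C, u x = φ (x 0)

theorem IsTimeFun.pd_eq_zero {C : Set (Fin 4 → ℝ)} (hC : IsOpen C) (hu : IsTimeFun C u)
    (hx : x ∈ C) {μ : Fin 4} (hμ : μ ≠ 0) : pd μ u x = 0 := by
  obtain ⟨φ, hφ⟩ := hu
  rw [pd_congr hC hφ hx]
  simp [pd, Function.update_of_ne hμ.symm]

/-- `deriv` is total, so even its default values depend on the time only. This lets the property
pass through all `□^l` without any smoothness. -/
theorem IsTimeFun.pd_zero {C : Set (Fin 4 → ℝ)} (hC : IsOpen C) (hu : IsTimeFun C u) :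
    IsTimeFun C (pd 0 u) := by
  obtain ⟨φ, hφ⟩ := hu
  refine ⟨deriv φ, fun x hx => ?_⟩
  rw [pd_congr hC hφ hx]
  simp [pd]

/-- The coefficients of the Hessian of a function of the time with respect to the FLRW metric. -/
def flrwHess (a : ℝ → ℝ) (u : (Fin 4 → ℝ) → ℝ) (x : Fin 4 → ℝ) : Fin 4 → ℝ :=
  let s := -(deriv a (x 0) / a (x 0) * pd 0 u x)
  ![-pd 0 (pd 0 u) x, s, s, s]

/-- Only `Γ^0_{μν}` meets a nonzero derivative of `u`, and its spatial part is `(a'/a) g_{ij}`,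
which makes the Hessian isotropic. -/
theorem IsTimeFun.hess_flrw (ha : ScaleFactor I a) (hu : IsTimeFun (flrwChart k I) u)
    (hx : x ∈ flrwChart k I) (μ ν : Fin 4) :
    hess (flrw k a) u μ ν x = flrwHess a u x μ * flrw k a x μ ν := by
  have hC := isOpen_flrwChart k ha.isOpen
  have h1 (i : Fin 4) (hi : i ≠ 0) : pd i u x = 0 := hu.pd_eq_zero hC hx hi
  have h2 (i j : Fin 4) (hij : i ≠ 0 ∨ j ≠ 0) : pd i (pd j u) x = 0 := by
    by_cases hj : j = 0
    · subst hj
      exact (hu.pd_zero hC).pd_eq_zero hC hx (by simpa using hij)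
    · rw [pd_congr hC (v := fun _ => 0) (fun y hy => hu.pd_eq_zero hC hy hj) hx, pd_const]
  have h3 : ∑ l, christoffel (flrw k a) l μ ν x * pd l u x =
      flrwGamma k a 0 μ ν x * pd 0 u x := by
    rw [Finset.sum_eq_single 0 (fun l _ hl => by rw [h1 l hl, mul_zero]) (by simp),
      christoffel_flrw ha hx]
  rw [hess, h3, flrw_apply]
  have ha0 := (ha.pos _ hx.1).ne'
  fin_cases μ <;> fin_cases ν <;>
    simp [h2, flrwGamma, flrwHess, flrwDiag, sepProd] <;> field_simp

theorem IsTimeFun.box_flrw (ha : ScaleFactor I a) (hu : IsTimeFun (flrwChart k I) u)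
    (hx : x ∈ flrwChart k I) : box (flrw k a) u x = ∑ μ, flrwHess a u x μ := by
  simp only [box, hu.hess_flrw ha hx]
  exact sum_invMetric_mul_flrw ha hx _

theorem IsTimeFun.gradDot_flrw (ha : ScaleFactor I a) (hu : IsTimeFun (flrwChart k I) u)
    (hx : x ∈ flrwChart k I) : gradDot (flrw k a) u v x = -(pd 0 u x * pd 0 v x) := by
  have hC := isOpen_flrwChart k ha.isOpen
  simp only [gradDot, mul_assoc]
  rw [sum_invMetric_mul ha hx fun μ ν => pd μ u x * pd ν v x, Finset.sum_eq_single 0]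
  · simp [flrwInv]
  · intro μ _ hμ
    simp [hu.pd_eq_zero hC hx hμ]
  · simp

theorem IsTimeFun.box (ha : ScaleFactor I a) (hu : IsTimeFun (flrwChart k I) u) :
    IsTimeFun (flrwChart k I) (box (flrw k a) u) := by
  have hC := isOpen_flrwChart k ha.isOpen
  obtain ⟨φ, hφ⟩ := hu.pd_zero hC
  obtain ⟨ψ, hψ⟩ := (hu.pd_zero hC).pd_zero hC
  refine ⟨fun t => -ψ t - 3 * (deriv a t / a t * φ t), fun x hx => ?_⟩
  rw [hu.box_flrw ha hx]
  simp only [Fin.sum_univ_four, flrwHess, hφ x hx, hψ x hx]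
  simp
  ring

theorem IsTimeFun.boxPow (ha : ScaleFactor I a) (hu : IsTimeFun (flrwChart k I) u) (l : ℕ) :
    IsTimeFun (flrwChart k I) (boxPow (flrw k a) l u) := by
  induction l with
  | zero => exact hu
  | succ l ih =>
    rw [NonlocalGravity.boxPow, Function.iterate_succ_apply']
    exact ih.box ha

theorem isTimeFun_ofR (ha : ScaleFactor I a) (H : ℝ → ℝ) :
    IsTimeFun (flrwChart k I) (ofR (flrw k a) H) :=
  ⟨fun t => H (∑ μ, flrwRicci k a t μ), fun x hx => by rw [ofR, scalarCurvature_eq_sum ha hx]⟩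

theorem IsTimeFun.opF (ha : ScaleFactor I a) (hu : IsTimeFun (flrwChart k I) u) :
    IsTimeFun (flrwChart k I) (opF (flrw k a) f u) := by
  choose φ hφ using hu.boxPow ha
  exact ⟨fun t => seriesSum fun m => f m * φ m t,
    fun x hx => by simp only [NonlocalGravity.opF, hφ _ x hx]⟩

theorem isTimeFun_Phi (ha : ScaleFactor I a) :
    IsTimeFun (flrwChart k I) (Phi (flrw k a) f H G) := by
  obtain ⟨φ₁, h₁⟩ := isTimeFun_ofR (k := k) ha (deriv H)
  obtain ⟨φ₂, h₂⟩ := isTimeFun_ofR (k := k) ha (deriv G)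
  obtain ⟨ψ₁, h₃⟩ := (isTimeFun_ofR (k := k) ha G).opF (f := f) ha
  obtain ⟨ψ₂, h₄⟩ := (isTimeFun_ofR (k := k) ha H).opF (f := f) ha
  exact ⟨fun t => φ₁ t * ψ₁ t + φ₂ t * ψ₂ t, fun x hx => by
    rw [Phi, h₁ x hx, h₂ x hx, h₃ x hx, h₄ x hx]⟩

/-! ### Diagonal form of the field equations -/

/-- The coefficients of `eomTerm` with respect to the FLRW metric. -/
def flrwTerm (k : ℝ) (a : ℝ → ℝ) (f : ℕ → ℝ) (H G : ℝ → ℝ) (x : Fin 4 → ℝ) (μ : Fin 4)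
    (m : ℕ) : ℝ :=
  f m * ∑ l ∈ Finset.range m,
    ((if μ = 0 then -1 else 1) * gradDot (flrw k a) (boxPow (flrw k a) l (ofR (flrw k a) H))
        (boxPow (flrw k a) (m - 1 - l) (ofR (flrw k a) G)) x
      + boxPow (flrw k a) l (ofR (flrw k a) H) x
        * boxPow (flrw k a) (m - l) (ofR (flrw k a) G) x)

/-- Since `g_00 = -1` and `∂^α u ∂_α v = -u̇ v̇`, the term `-2 u̇ v̇` equals `-2 g_00 ∂^α u ∂_α v`.
It turns the coefficient of the gradient term from `1` into `-1` for `μ = ν = 0` and vanishes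
otherwise. -/
theorem eomTerm_flrw (ha : ScaleFactor I a) (hx : x ∈ flrwChart k I) (μ ν : Fin 4) (m : ℕ) :
    eomTerm (flrw k a) f H G μ ν x m = flrwTerm k a f H G x μ m * flrw k a x μ ν := by
  rw [eomTerm, flrwTerm, mul_assoc, Finset.sum_mul]
  congr 1
  refine Finset.sum_congr rfl fun l _ => ?_
  have hC := isOpen_flrwChart k ha.isOpen
  have h1 := (isTimeFun_ofR (k := k) ha H).boxPow ha l
  have h2 := (isTimeFun_ofR (k := k) ha G).boxPow ha (m - 1 - l)
  rw [h1.gradDot_flrw ha hx]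
  by_cases hμ : μ = 0
  · by_cases hν : ν = 0
    · subst hμ hν
      simp [flrw]
      ring
    · rw [h2.pd_eq_zero hC hx hν]
      simp [flrw, hμ, Matrix.diagonal_apply_ne _ (Ne.symm hν)]
  · rw [h1.pd_eq_zero hC hx hμ, if_neg hμ]
    ring

/-- Summing over `μ`, the gradient term is counted `-1 + 3 = 2` times and the other term `4` times;
halving gives the weights `1` and `2`. -/
theorem traceTerm_flrw (m : ℕ) :
    traceTerm (flrw k a) f H G x m =
      (1 / 2) * ∑ μ, flrwTerm k a f H G x μ m := by
  simp only [traceTerm, flrwTerm, Fin.sum_univ_four, ← mul_add, ← Finset.sum_add_distrib]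
  rw [mul_left_comm]
  congr 1
  rw [Finset.mul_sum]
  refine Finset.sum_congr rfl fun l _ => ?_
  simp
  ring

/-- The coefficients of `eom` with respect to the FLRW metric. -/
def flrwEom (k : ℝ) (a : ℝ → ℝ) (N Λ : ℝ) (f : ℕ → ℝ) (H G : ℝ → ℝ) (x : Fin 4 → ℝ)
    (μ : Fin 4) : ℝ :=
  (flrwRicci k a (x 0) μ - (1 / 2) * scalarCurvature (flrw k a) x + Λ) / (16 * Real.pi * N)
    - (1 / 2) * ofR (flrw k a) H x * opF (flrw k a) f (ofR (flrw k a) G) x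
    + (flrwRicci k a (x 0) μ * Phi (flrw k a) f H G x
      - (flrwHess a (Phi (flrw k a) f H G) x μ - box (flrw k a) (Phi (flrw k a) f H G) x))
    + (1 / 2) * seriesSum (flrwTerm k a f H G x μ)

theorem eom_flrw (ha : ScaleFactor I a) (hx : x ∈ flrwChart k I) (N Λ : ℝ) (μ ν : Fin 4) :
    eom (flrw k a) N Λ f H G μ ν x = flrwEom k a N Λ f H G x μ * flrw k a x μ ν := by
  have h : seriesSum (eomTerm (flrw k a) f H G μ ν x) =
      seriesSum (flrwTerm k a f H G x μ) * flrw k a x μ ν := by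
    rw [seriesSum, seriesSum, ← tsum_mul_right]
    simp only [eomTerm_flrw ha hx]
  rw [eom, flrwEom, h, einstein, opK, ricci_flrw ha hx, (isTimeFun_Phi ha).hess_flrw ha hx]
  ring

theorem flrwEom_spatial (N Λ : ℝ) {i : Fin 4} (hi : i ≠ 0) :
    flrwEom k a N Λ f H G x i = flrwEom k a N Λ f H G x 1 := by
  have h : flrwTerm k a f H G x i = flrwTerm k a f H G x 1 := by
    funext m
    simp [flrwTerm, hi]
  rw [flrwEom, flrwEom, h]
  fin_cases i
  · exact absurd rfl hi
  all_goals rfl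

theorem Admissible.scaleFactor {U : Set ℝ} (h : Admissible k U f H G I a) : ScaleFactor I a :=
  ⟨h.isOpen, h.contDiffOn, h.pos⟩

/-- Convergence passes from the `μμ` component to its coefficient because `g_{μμ} ≠ 0`. -/
theorem Admissible.converges_flrwTerm {U : Set ℝ} (h : Admissible k U f H G I a)
    (hx : x ∈ flrwChart k I) (μ : Fin 4) : SeriesConverges (flrwTerm k a f H G x μ) := by
  have ha := h.scaleFactor
  have h0 : flrw k a x μ μ ≠ 0 := right_ne_zero_of_mul_eq_one (flrwInv_mul_flrw ha hx μ)
  refine (summable_mul_right_iff h0).1 ?_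
  simpa only [← eomTerm_flrw ha hx] using h.converges_eom x hx μ μ

theorem Admissible.hasSum_traceTerm {U : Set ℝ} (h : Admissible k U f H G I a)
    (hx : x ∈ flrwChart k I) :
    HasSum (traceTerm (flrw k a) f H G x)
      ((1 / 2) * ∑ μ, seriesSum (flrwTerm k a f H G x μ)) (SummationFilter.conditional ℕ) := by
  have : traceTerm (flrw k a) f H G x = fun m => (1 / 2) * ∑ μ, flrwTerm k a f H G x μ m :=
    funext traceTerm_flrw
  rw [this]
  exact (hasSum_sum fun μ _ => (h.converges_flrwTerm hx μ).hasSum).mul_left _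

theorem Admissible.traceEq_flrw {U : Set ℝ} (h : Admissible k U f H G I a)
    (hx : x ∈ flrwChart k I) (N Λ : ℝ) :
    traceEq (flrw k a) N Λ f H G x = ∑ μ, flrwEom k a N Λ f H G x μ := by
  have ha := h.scaleFactor
  rw [traceEq, seriesSum, (h.hasSum_traceTerm hx).tsum_eq]
  simp only [flrwEom, (isTimeFun_Phi ha).box_flrw ha hx, scalarCurvature_eq_sum ha hx,
    Fin.sum_univ_four]
  ring

theorem Admissible.field_equations {U : Set ℝ} (h : Admissible k U f H G I a)
    (hx : x ∈ flrwChart k I) (N Λ : ℝ) :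
    (∀ μ ν : Fin 4, μ ≠ ν → eom (flrw k a) N Λ f H G μ ν x = 0) ∧
    (∃ c : ℝ, ∀ i : Fin 4, i ≠ 0 → eom (flrw k a) N Λ f H G i i x = c * flrw k a x i i) ∧
    SeriesConverges (traceTerm (flrw k a) f H G x) ∧
    traceEq (flrw k a) N Λ f H G x =
      ∑ μ, ∑ ν, invMetric (flrw k a) x μ ν * eom (flrw k a) N Λ f H G μ ν x ∧
    ((∀ μ ν : Fin 4, eom (flrw k a) N Λ f H G μ ν x = 0) ↔
      traceEq (flrw k a) N Λ f H G x = 0 ∧ eom (flrw k a) N Λ f H G 0 0 x = 0) := by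
  have ha := h.scaleFactor
  have ht := h.traceEq_flrw hx N Λ
  simp only [eom_flrw ha hx]
  refine ⟨fun μ ν hμν => ?_, ⟨_, fun i hi => by rw [flrwEom_spatial N Λ hi]⟩,
    (h.hasSum_traceTerm hx).summable, ?_, fun h0 => ?_, fun ⟨h0, h1⟩ => ?_⟩
  · rw [flrw, Matrix.diagonal_apply_ne _ hμν, mul_zero]
  · rw [ht, sum_invMetric_mul_flrw ha hx]
  · refine ⟨?_, h0 0 0⟩
    rw [ht]
    refine Finset.sum_eq_zero fun μ _ => ?_
    exact (mul_eq_zero.1 (h0 μ μ)).resolve_right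
      (right_ne_zero_of_mul_eq_one (flrwInv_mul_flrw ha hx μ))
  · have h2 : flrwEom k a N Λ f H G x 0 = 0 := by simpa [flrw] using h1
    rw [ht, Fin.sum_univ_four, flrwEom_spatial N Λ (i := 2) (by decide),
      flrwEom_spatial N Λ (i := 3) (by decide), h2] at h0
    have h3 : flrwEom k a N Λ f H G x 1 = 0 := by linarith
    intro μ ν
    by_cases hμ : μ = 0
    · rw [hμ, h2, zero_mul]
    · rw [flrwEom_spatial N Λ hμ, h3, zero_mul]

/-! ### Scale factors of constant scalar curvature -/

theorem exists_solution_linear_ode {c : ℝ} (hc : c ≠ 0) (d t₀ y₀ y₁ : ℝ) :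
    ∃ y : ℝ → ℝ, ContDiff ℝ ∞ y ∧ y t₀ = y₀ ∧ deriv y t₀ = y₁ ∧
      ∀ t, deriv (deriv y) t = c * y t - d := by
  -- A complex square root of `c` treats both signs of `c` at once: `cosh` and `sinh` of `w (t -
  -- t₀)` cover the trigonometric case too.
  obtain ⟨w, hw⟩ := IsAlgClosed.exists_pow_nat_eq (c : ℂ) (n := 2) (by norm_num)
  have hw0 : w ≠ 0 := by
    rintro rfl
    exact hc (by simpa using hw.symm)
  have harg (t : ℝ) : HasDerivAt (fun t : ℝ => w * ((t : ℂ) - t₀)) w t := by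
    simpa using ((Complex.ofRealCLM.hasDerivAt (x := t)).sub_const (t₀ : ℂ)).const_mul w
  have hre {F : ℝ → ℂ} {F' : ℂ} {t : ℝ} (h : HasDerivAt F F' t) :
      HasDerivAt (fun t => (F t).re) F'.re t := Complex.reCLM.hasFDerivAt.comp_hasDerivAt t h
  let S : ℝ → ℂ := fun t => Complex.sinh (w * ((t : ℂ) - t₀))
  let C : ℝ → ℂ := fun t => Complex.cosh (w * ((t : ℂ) - t₀))
  have hS (t : ℝ) : HasDerivAt S (C t * w) t := (Complex.hasDerivAt_sinh _).comp t (harg t)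
  have hC (t : ℝ) : HasDerivAt C (S t * w) t := (Complex.hasDerivAt_cosh _).comp t (harg t)
  -- The equilibrium `d / c` plus a homogeneous solution with the prescribed initial data; as `c` is
  -- real, the real part still solves the equation.
  let y : ℝ → ℝ := fun t => (((y₀ - d / c : ℝ) : ℂ) * C t + y₁ / w * S t).re + d / c
  have h1 (t : ℝ) : HasDerivAt y
      (((y₀ - d / c : ℝ) : ℂ) * (S t * w) + y₁ / w * (C t * w)).re t :=
    (hre (((hC t).const_mul _).add ((hS t).const_mul _))).add_const _
  have h2 : deriv y = fun t =>
      (((y₀ - d / c : ℝ) : ℂ) * (S t * w) + y₁ / w * (C t * w)).re :=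
    funext fun t => (h1 t).deriv
  have h3 (t : ℝ) : HasDerivAt (deriv y)
      (((y₀ - d / c : ℝ) : ℂ) * (C t * w * w) + y₁ / w * (S t * w * w)).re t := by
    rw [h2]
    exact hre ((((hS t).mul_const w).const_mul _).add (((hC t).mul_const w).const_mul _))
  refine ⟨y, ?_, by simp [y, S, C], ?_, fun t => ?_⟩
  · have hw' : ContDiff ℝ ∞ fun t : ℝ => w * ((t : ℂ) - t₀) :=
      contDiff_const.mul (Complex.ofRealCLM.contDiff.sub contDiff_const)
    have hS' : ContDiff ℝ ∞ S := (Complex.contDiff_sinh.restrict_scalars ℝ).comp hw'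
    have hC' : ContDiff ℝ ∞ C := (Complex.contDiff_cosh.restrict_scalars ℝ).comp hw'
    exact (Complex.reCLM.contDiff.comp
      ((contDiff_const.mul hC').add (contDiff_const.mul hS'))).add contDiff_const
  · simp [h2, S, C, hw0]
  · rw [(h3 t).deriv]
    have : ((y₀ - d / c : ℝ) : ℂ) * (C t * w * w) + y₁ / w * (S t * w * w) =
        (c : ℂ) * (((y₀ - d / c : ℝ) : ℂ) * C t + y₁ / w * S t) := by
      rw [← hw]; ring
    rw [this, Complex.re_ofReal_mul]
    simp only [y]
    field_simp
    ring

theorem exists_scaleFactor_const_curvature (k : ℝ) {r : ℝ} (hr : r ≠ 0) {a₀ : ℝ} (ha₀ : 0 < a₀)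
    (t₀ v : ℝ) :
    ∃ (I : Set ℝ) (a : ℝ → ℝ), ScaleFactor I a ∧ ContDiffOn ℝ ∞ a I ∧ t₀ ∈ I ∧ a t₀ = a₀ ∧
      deriv a t₀ = v ∧ ∀ x ∈ flrwChart k I, scalarCurvature (flrw k a) x = r := by
  -- For `y = a²`, the nonlinear equation `R = r` becomes the linear one `y'' = (r/3) y - 2k`. The
  -- scale factor is `√y` where `y > 0`.
  obtain ⟨y, hy, hy0, hy1, hy2⟩ := exists_solution_linear_ode (c := r / 3) (by positivity) (2 * k)
    t₀ (a₀ ^ 2) (2 * a₀ * v)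
  have hI : IsOpen {t | 0 < y t} := isOpen_lt continuous_const hy.continuous
  have hs : ContDiffOn ℝ ∞ (fun t => √(y t)) {t | 0 < y t} :=
    hy.contDiffOn.sqrt fun t ht => ne_of_gt ht
  have ha : ScaleFactor {t | 0 < y t} (fun t => √(y t)) :=
    ⟨hI, hs.of_le (WithTop.coe_le_coe.2 (show (2 : ℕ∞) ≤ ⊤ from le_top)),
      fun t ht => Real.sqrt_pos.2 ht⟩
  have ht₀ : t₀ ∈ {t | 0 < y t} := by simp only [Set.mem_ofPred_eq, hy0]; positivity
  have hat₀ : √(y t₀) = a₀ := by rw [hy0, Real.sqrt_sq ha₀.le]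
  generalize hb : (fun t => √(y t)) = b at hs ha
  have hsq : ∀ t ∈ {t | 0 < y t}, y t = b t ^ 2 := fun t ht => by
    rw [← hb, Real.sq_sqrt (le_of_lt ht)]
  have hd : ∀ t ∈ {t | 0 < y t}, deriv y t = 2 * (b t * deriv b t) := fun t ht => by
    rw [Filter.EventuallyEq.deriv_eq (Filter.eventuallyEq_of_mem (hI.mem_nhds ht) hsq),
      deriv_sq_scale ha ht, mul_assoc]
  have hdd : ∀ t ∈ {t | 0 < y t}, deriv (deriv y) t =
      2 * (deriv b t ^ 2 + b t * deriv (deriv b) t) := fun t ht => by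
    rw [Filter.EventuallyEq.deriv_eq (Filter.eventuallyEq_of_mem (hI.mem_nhds ht) hd),
      deriv_const_mul_field, deriv_mul_deriv_scale ha ht]
  have hbt₀ : b t₀ = a₀ := by rw [← hb, ← hat₀]
  refine ⟨_, b, ha, hs, ht₀, hbt₀, ?_, fun x hx => ?_⟩
  · have := hd t₀ ht₀
    rw [hy1, hbt₀, mul_assoc] at this
    exact (mul_left_cancel₀ ha₀.ne' (mul_left_cancel₀ two_ne_zero this)).symm
  · have h1 := hdd _ hx.1
    have h2 := (ha.pos _ hx.1).ne'
    rw [hy2, hsq _ hx.1] at h1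
    rw [scalarCurvature_flrw ha hx]
    field_simp
    linear_combination (-3 : ℝ) * h1

theorem box_flrw_const (ha : ScaleFactor I a) {c : ℝ} (hu : ∀ x ∈ flrwChart k I, u x = c)
    (hx : x ∈ flrwChart k I) : box (flrw k a) u x = 0 := by
  have hC := isOpen_flrwChart k ha.isOpen
  have h1 : ∀ y ∈ flrwChart k I, pd 0 u y = 0 := fun y hy => by
    rw [pd_congr hC hu hy, pd_const]
  have h2 : pd 0 (pd 0 u) x = 0 := by rw [pd_congr hC h1 hx, pd_const]
  rw [IsTimeFun.box_flrw ha ⟨fun _ => c, hu⟩ hx]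
  simp [Fin.sum_univ_four, flrwHess, h1 x hx, h2]

theorem boxPow_flrw_const (ha : ScaleFactor I a) {c : ℝ} (hu : ∀ x ∈ flrwChart k I, u x = c)
    (l : ℕ) (hx : x ∈ flrwChart k I) :
    boxPow (flrw k a) l u x = if l = 0 then c else 0 := by
  induction l generalizing x with
  | zero => exact hu x hx
  | succ l ih =>
    rw [boxPow, Function.iterate_succ_apply']
    exact box_flrw_const ha (fun x hx => ih hx) hx

theorem hasSum_opF_const (ha : ScaleFactor I a) {c : ℝ} (hu : ∀ x ∈ flrwChart k I, u x = c)
    (hx : x ∈ flrwChart k I) :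
    HasSum (fun m => f m * boxPow (flrw k a) m u x) (f 0 * c)
      (SummationFilter.conditional ℕ) := by
  simp only [boxPow_flrw_const ha hu _ hx, mul_ite, mul_zero]
  simpa using hasSum_single (f := fun m => if m = 0 then f m * c else 0)
    (L := SummationFilter.conditional ℕ) 0 (fun m hm => if_neg hm)

theorem Phi_flrw_const (ha : ScaleFactor I a) {r : ℝ}
    (hR : ∀ x ∈ flrwChart k I, scalarCurvature (flrw k a) x = r) (hx : x ∈ flrwChart k I) :
    Phi (flrw k a) f H G x = deriv H r * (f 0 * G r) + deriv G r * (f 0 * H r) := by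
  have h (F : ℝ → ℝ) : ∀ x ∈ flrwChart k I, ofR (flrw k a) F x = F r := fun x hx => by
    rw [ofR, hR x hx]
  rw [Phi, opF, opF, seriesSum, seriesSum, (hasSum_opF_const ha (h G) hx).tsum_eq,
    (hasSum_opF_const ha (h H) hx).tsum_eq, h _ x hx, h _ x hx]

/-- Each series reduces to its term of index `0` or to zero, and every function to be differentiated
is constant on the chart. -/
theorem admissible_of_const_curvature {U : Set ℝ} (ha : ScaleFactor I a) {r : ℝ} (hr : r ∈ U)
    (hR : ∀ x ∈ flrwChart k I, scalarCurvature (flrw k a) x = r) :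
    Admissible k U f H G I a := by
  have h (F : ℝ → ℝ) : ∀ x ∈ flrwChart k I, ofR (flrw k a) F x = F r := fun x hx => by
    rw [ofR, hR x hx]
  have hC := isOpen_flrwChart k ha.isOpen
  refine ⟨ha.isOpen, ha.contDiffOn, ha.pos, fun x hx => by rwa [hR x hx],
    fun m _ l _ => ⟨?_, ?_⟩, ?_, fun x hx => ⟨(hasSum_opF_const ha (h H) hx).summable,
      (hasSum_opF_const ha (h G) hx).summable⟩, fun x hx μ ν => ?_⟩
  · exact contDiffOn_const.congr fun x hx => boxPow_flrw_const ha (h H) l hx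
  · exact contDiffOn_const.congr fun x hx => boxPow_flrw_const ha (h G) l hx
  · exact contDiffOn_const.congr fun x hx => Phi_flrw_const ha hR hx
  · have h0 : flrwTerm k a f H G x μ = fun _ => 0 := by
      funext m
      rw [flrwTerm, Finset.sum_eq_zero, mul_zero]
      intro l hl
      -- Since `l < m`, the second factor carries at least one `□`, which kills a constant.
      have hlm : m - l ≠ 0 := by have := Finset.mem_range.1 hl; omega
      rw [((isTimeFun_ofR ha H).boxPow ha l).gradDot_flrw ha hx,
        pd_congr hC (fun y hy => boxPow_flrw_const ha (h H) l hy) hx, pd_const,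
        boxPow_flrw_const ha (h G) _ hx, if_neg hlm]
      simp
    have h1 : eomTerm (flrw k a) f H G μ ν x = fun _ => 0 := by
      funext m
      rw [eomTerm_flrw ha hx, h0, zero_mul]
    rw [h1]
    exact summable_zero

/-! ### Linear independence of the two equations -/

theorem traceEq_sub (N N' Λ : ℝ) :
    traceEq (flrw k a) N Λ f H G x - traceEq (flrw k a) N' Λ f H G x =
      (4 * Λ - scalarCurvature (flrw k a) x) *
        (1 / (16 * Real.pi * N) - 1 / (16 * Real.pi * N')) := by
  simp only [traceEq]
  ring

theorem eom_sub (g : (Fin 4 → ℝ) → Matrix (Fin 4) (Fin 4) ℝ) (N N' Λ : ℝ) (μ ν : Fin 4) :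
    eom g N Λ f H G μ ν x - eom g N' Λ f H G μ ν x =
      (einstein g μ ν x + Λ * g x μ ν) *
        (1 / (16 * Real.pi * N) - 1 / (16 * Real.pi * N')) := by
  simp only [eom]
  ring

theorem einstein_flrw_zero_zero (ha : ScaleFactor I a) (hx : x ∈ flrwChart k I) :
    einstein (flrw k a) 0 0 x =
      3 * ((deriv a (x 0) / a (x 0)) ^ 2 + k / a (x 0) ^ 2) := by
  rw [einstein, ricci_flrw ha hx, scalarCurvature_flrw ha hx]
  simp [flrw, flrwRicci]
  ring

theorem linearIndependent_traceEq_eom (k Λ : ℝ) {U : Set ℝ} (hU : IsOpen U) (hUne : U.Nonempty)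
    (f : ℕ → ℝ) (H G : ℝ → ℝ) (hx : x ∈ flrwChart k Set.univ) {a₀ : ℝ} (ha₀ : 0 < a₀) :
    LinearIndependent ℝ
      ![fun q : Family k U f H G (x 0) a₀ => traceEq (flrw k q.1.2.2) q.1.1 Λ f H G x,
        fun q : Family k U f H G (x 0) a₀ => eom (flrw k q.1.2.2) q.1.1 Λ f H G 0 0 x] := by
  obtain ⟨r₀, hr₀⟩ := hUne
  -- A nonempty open set is infinite, so two values can be avoided: `r ≠ 0` makes the linear
  -- equation for `a²` solvable as above, and `r ≠ 4Λ` is what yields `α = 0`.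
  obtain ⟨r, hrU, hr⟩ := ((infinite_of_mem_nhds r₀ (hU.mem_nhds hr₀)).sdiff
    (Set.toFinite {0, 4 * Λ})).nonempty
  simp only [Set.mem_insert_iff, Set.mem_singleton_iff, not_or] at hr
  rw [LinearIndependent.pair_iff]
  intro α β hαβ
  have key (v : ℝ) : α * (4 * Λ - r) + β * (3 * ((v / a₀) ^ 2 + k / a₀ ^ 2) - Λ) = 0 := by
    obtain ⟨I, a, ha, hs, ht, hat, hav, hR⟩ :=
      exists_scaleFactor_const_curvature k hr.1 ha₀ (x 0) v
    have hxI : x ∈ flrwChart k I := ⟨ht, hx.2⟩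
    have hadm : Admissible k U f H G I a := admissible_of_const_curvature ha hrU hR
    have h (N : ℝ) (hN : 0 < N) : α * traceEq (flrw k a) N Λ f H G x
        + β * eom (flrw k a) N Λ f H G 0 0 x = 0 :=
      congrFun hαβ ⟨(N, I, a), hN, hadm, hs, ht, hat⟩
    have h3 := traceEq_sub (k := k) (a := a) (f := f) (H := H) (G := G) (x := x) 1 2 Λ
    have h4 := eom_sub (f := f) (H := H) (G := G) (x := x) (flrw k a) 1 2 Λ 0 0
    rw [hR x hxI] at h3
    rw [einstein_flrw_zero_zero ha hxI, hat, hav, show flrw k a x 0 0 = -1 by simp [flrw]] at h4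
    have hpi : (1 / (16 * Real.pi * 1) - 1 / (16 * Real.pi * 2)) ≠ 0 := by
      have := Real.pi_ne_zero
      have h : 1 / (16 * Real.pi * 1) - 1 / (16 * Real.pi * 2) = 1 / (32 * Real.pi) := by
        field_simp; norm_num
      rw [h]; positivity
    refine (mul_eq_zero.1 ?_).resolve_right hpi
    linear_combination h 1 one_pos - h 2 two_pos - α * h3 - β * h4
  have hβ : β = 0 := by
    have h0 := key 0
    have h1 := key a₀
    rw [div_self ha₀.ne'] at h1
    -- Between `v = 0` and `v = a₀` the relation changes by exactly `3 β`.
    linear_combination (1 / 3 : ℝ) * (h1 - h0)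
  refine ⟨?_, hβ⟩
  have h0 := key 0
  rw [hβ, zero_mul, add_zero] at h0
  exact (mul_eq_zero.1 h0).resolve_right (sub_ne_zero.2 (Ne.symm hr.2))

end NonlocalGravity

end

theorem mainTheorem2 (k Λ : ℝ) (U : Set ℝ) (hU : IsOpen U) (hUne : U.Nonempty)
    (f : ℕ → ℝ) (H G : ℝ → ℝ) (hH : DifferentiableOn ℝ H U) (hG : DifferentiableOn ℝ G U) :
    (∀ (N : ℝ), N ≠ 0 → ∀ (I : Set ℝ) (a : ℝ → ℝ),
      NonlocalGravity.Admissible k U f H G I a →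
      ∀ x ∈ NonlocalGravity.flrwChart k I,
        (∀ μ ν : Fin 4, μ ≠ ν →
          NonlocalGravity.eom (NonlocalGravity.flrw k a) N Λ f H G μ ν x = 0) ∧
        (∃ c : ℝ, ∀ i : Fin 4, i ≠ 0 →
          NonlocalGravity.eom (NonlocalGravity.flrw k a) N Λ f H G i i x =
            c * NonlocalGravity.flrw k a x i i) ∧
        NonlocalGravity.SeriesConverges
          (NonlocalGravity.traceTerm (NonlocalGravity.flrw k a) f H G x) ∧
        NonlocalGravity.traceEq (NonlocalGravity.flrw k a) N Λ f H G x =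
          ∑ μ, ∑ ν, NonlocalGravity.invMetric (NonlocalGravity.flrw k a) x μ ν *
            NonlocalGravity.eom (NonlocalGravity.flrw k a) N Λ f H G μ ν x ∧
        ((∀ μ ν : Fin 4, NonlocalGravity.eom (NonlocalGravity.flrw k a) N Λ f H G μ ν x = 0) ↔
          NonlocalGravity.traceEq (NonlocalGravity.flrw k a) N Λ f H G x = 0 ∧
          NonlocalGravity.eom (NonlocalGravity.flrw k a) N Λ f H G 0 0 x = 0)) ∧
    (∀ x ∈ NonlocalGravity.flrwChart k Set.univ, ∀ a₀ : ℝ, 0 < a₀ →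
      LinearIndependent ℝ
        ![fun q : NonlocalGravity.Family k U f H G (x 0) a₀ =>
            NonlocalGravity.traceEq (NonlocalGravity.flrw k q.1.2.2) q.1.1 Λ f H G x,
          fun q : NonlocalGravity.Family k U f H G (x 0) a₀ =>
            NonlocalGravity.eom (NonlocalGravity.flrw k q.1.2.2) q.1.1 Λ f H G 0 0 x]) := by
  refine ⟨fun N _ I a h x hx => ?_, fun x hx a₀ ha₀ => ?_⟩
  · exact h.field_equations hx N Λ
  · exact NonlocalGravity.linearIndependent_traceEq_eom k Λ hU hUne f H G hx ha₀
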